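/- **Theorem 5.2.** Let $\mathcal X$ be a finite set, let $G$ be a finite commutative group (written additively), put $M=|\mathcal X|$ and $N=|G|$, and let $q<k\le M$ be non-negative integers. In the oracle interrogation problem a function $A:\mathcal X\to G$ is drawn uniformly at random, and an algorithm that may make $q$ quantum queries to $A$ has to output $k$ pairs $(x_1,y_1),\dots,(x_k,y_k)\in\mathcal X\times G$; it succeeds if the $x_i$ are pairwise distinct and $A(x_i)=y_i$ for all $i$. A $q$-query quantum algorithm has a register with basis states $|x,r,z\rangle$, where $z$ ranges over a workspace of arbitrary finite size; it starts in a unit vector not depending on $A$, makes $q$ queries, applies after each query a unitary not depending on $A$, and at the end measures in the standard basis, its output being a function of the outcome. A query is either the controlled-add operator $|x,g,z\rangle\mapsto|x,g+A(x),z\rangle$ ($g\in G$), or the phase operator $|x,\xi,z\rangle\mapsto\xi(A(x))\,|x,\xi,z\rangle$ ($\xi$ a character of $G$). In each of these two query models, the maximum, over all $q$-query quantum algorithms, of the success probability (over the random choice of $A$ and the final measurement) is attained and equals exactly $$\frac1{N^k}\sum_{i=0}^{q}\binom{k}{i}(N-1)^i .$$ -/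

import Mathlib

open scoped BigOperators Matrix

/-- A quantum algorithm making `q` oracle queries with outcomes in `Y`. The basis states of its
register are `|x, r, z⟩` with `x : X` the query input, `r : R` the response register, and `z` a
workspace of arbitrary finite dimension. It starts in a unit vector `init` independent of the
oracle, applies the unitary `step i` right after the `i`-th query, and finally measures all
registers in the standard basis, reading its output off the measured basis state. -/
structure QueryAlgorithm (X R Y : Type*) [Fintype X] [DecidableEq X] [Fintype R] [DecidableEq R]
    (q : ℕ) where
  /-- dimension of the workspace -/
  w : ℕ
  /-- amplitudes of the initial state -/
  init : X × R × Fin w → ℂ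
  init_unit : ∑ b, ‖init b‖ ^ 2 = 1
  /-- the oracle-independent unitary applied after each query -/
  step : Fin q → Matrix.unitaryGroup (X × R × Fin w) ℂ
  /-- the classical output attached to each measurement outcome -/
  out : X × R × Fin w → Y

/-- Alternately apply the query operator `O` and the unitaries `U 0, …, U (q - 1)` to `v`. -/
noncomputable def runQueries {B : Type*} [Fintype B] [DecidableEq B] (O : Matrix B B ℂ) :
    {q : ℕ} → (Fin q → Matrix.unitaryGroup B ℂ) → (B → ℂ) → (B → ℂ)
  | 0, _, v => v
  | q + 1, U, v =>
      (U (Fin.last q) : Matrix B B ℂ) *ᵥ (O *ᵥ runQueries O (fun i : Fin q => U i.castSucc) v)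

/-- The controlled-add query `|x, g, z⟩ ↦ |x, g + A x, z⟩`. -/
def addQuery {X G : Type*} [DecidableEq X] [AddCommGroup G] [DecidableEq G] (w : ℕ) (A : X → G) :
    Matrix (X × G × Fin w) (X × G × Fin w) ℂ :=
  Matrix.of fun b' b => if b' = (b.1, b.2.1 + A b.1, b.2.2) then 1 else 0

/-- The phase query `|x, ξ, z⟩ ↦ ξ (A x) |x, ξ, z⟩`, where `ξ` is a character of `G`. -/
noncomputable def phaseQuery {X G : Type*} [DecidableEq X] [AddCommGroup G] (w : ℕ) (A : X → G) :
    Matrix (X × AddChar G ℂ × Fin w) (X × AddChar G ℂ × Fin w) ℂ :=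
  Matrix.diagonal fun b => b.2.1 (A b.1)

/-- The list `y` consists of `k` input/output pairs of `A` with pairwise distinct inputs. -/
def IsInterrogation {X G : Type*} {k : ℕ} (A : X → G) (y : Fin k → X × G) : Prop :=
  Function.Injective (fun i => (y i).1) ∧ ∀ i, A (y i).1 = (y i).2

open Classical in
/-- The probability that `alg`, querying a fixed oracle `A` through the query operators `query`,
outputs `k` correct input/output pairs of `A` with distinct inputs. -/
noncomputable def successProbOn {X R G : Type*} [Fintype X] [DecidableEq X] [Fintype R]
    [DecidableEq R] {q k : ℕ}
    (query : (w : ℕ) → (X → G) → Matrix (X × R × Fin w) (X × R × Fin w) ℂ)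
    (alg : QueryAlgorithm X R (Fin k → X × G) q) (A : X → G) : ℝ :=
  ∑ b, if IsInterrogation A (alg.out b) then
    ‖runQueries (query alg.w A) alg.step alg.init b‖ ^ 2 else 0

/-- The success probability of `alg` in oracle interrogation, over a uniformly random oracle
`A : X → G` and the measurement of the algorithm. -/
noncomputable def successProb {X R G : Type*} [Fintype X] [DecidableEq X] [Fintype R]
    [DecidableEq R] [Fintype G] {q k : ℕ}
    (query : (w : ℕ) → (X → G) → Matrix (X × R × Fin w) (X × R × Fin w) ℂ)
    (alg : QueryAlgorithm X R (Fin k → X × G) q) : ℝ :=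
  (∑ A : X → G, successProbOn query alg A) / (Fintype.card (X → G) : ℝ)

/-! Let `D` be the number of characters of `G ^ k` with at most `q` nontrivial coordinates; the
claimed value is `D / N ^ k`. Upper bound: a query brings in the value of `A` at one point, so each
final amplitude, as a function of `A`, is a combination of characters of `X → G` of weight at most
`q` (`runQueries_mem_lowDegree`). For an outcome that names distinct points, freeze `A` elsewhere:
what remains is a function on `G ^ k` spanned by `D` characters. Parseval and Cauchy–Schwarz bound
its squared modulus at one point by `D / N ^ k` times its total mass
(`norm_sq_apply_le_of_mem_lowDegree`). Summing over frozen values and outcomes, with unitarity,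
gives `successProb_le`. Lower bound: fix `k` distinct points, put the workspace in uniform
superposition over these `D` characters, and evaluate each at the values of `A` by `q` phase
queries. An inverse Fourier transform then gives the true values the amplitude `D / √(D * N ^ k)`
(`exists_successProb_eq`). Controlled-add queries become phase queries in the Fourier basis of the
response register (`exists_addQuery_diagonalization`). -/

set_option linter.unusedSectionVars false

/-! ### Characters of bounded weight and the functions they span -/

section Characters

variable {ι X G : Type*} [Fintype ι] [DecidableEq ι] [Fintype X] [DecidableEq X]
  [AddCommGroup G] [Fintype G] [DecidableEq G]

/-- The character of `ι → G` that is the product of the characters `c i` of the coordinates. -/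
noncomputable def prodChar (c : ι → AddChar G ℂ) (u : ι → G) : ℂ := ∏ i, c i (u i)

lemma norm_prodChar (c : ι → AddChar G ℂ) (u : ι → G) : ‖prodChar c u‖ = 1 := by
  simp [prodChar, norm_prod, AddChar.norm_apply]

lemma sum_addChar_mul_conj (ψ φ : AddChar G ℂ) :
    ∑ g, ψ g * (starRingEnd ℂ) (φ g) = if ψ = φ then (Fintype.card G : ℂ) else 0 := by
  have h := AddChar.sum_eq_ite (ψ - φ)
  simp only [sub_eq_zero] at h
  rw [← h]
  refine Finset.sum_congr rfl fun g _ => ?_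
  rw [AddChar.sub_apply, ← AddChar.map_neg_eq_conj]

lemma sum_prodChar_mul_conj (c d : ι → AddChar G ℂ) :
    ∑ u, prodChar c u * (starRingEnd ℂ) (prodChar d u) =
      if c = d then (Fintype.card G : ℂ) ^ Fintype.card ι else 0 := by
  have h : ∀ u : ι → G, prodChar c u * (starRingEnd ℂ) (prodChar d u) =
      ∏ i, c i (u i) * (starRingEnd ℂ) (d i (u i)) := fun u => by
    simp [prodChar, Finset.prod_mul_distrib]
  simp_rw [h]
  rw [← Fintype.prod_sum (fun i g => c i g * (starRingEnd ℂ) (d i g))]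
  simp_rw [sum_addChar_mul_conj]
  split_ifs with hcd
  · simp [hcd]
  · obtain ⟨i, hi⟩ := Function.ne_iff.1 hcd
    exact Finset.prod_eq_zero (Finset.mem_univ i) (if_neg hi)

/-- The number of nontrivial coordinates. -/
def weight {α : Type*} [Zero α] [DecidableEq α] (c : ι → α) : ℕ :=
  (Finset.univ.filter fun i => c i ≠ 0).card

/-- Sort by support: each coordinate in the support has `card α - 1` nonzero choices, and all others
are forced to be zero. -/
lemma card_weight_le {α : Type*} [Zero α] [DecidableEq α] [Fintype α] (q : ℕ) :
    (Finset.univ.filter fun c : ι → α => weight c ≤ q).card =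
      ∑ i ∈ Finset.range (q + 1), (Fintype.card ι).choose i * (Fintype.card α - 1) ^ i := by
  have hsupp : ∀ s : Finset ι, (Finset.univ.filter fun c : ι → α =>
      (Finset.univ.filter fun i => c i ≠ 0) = s).card = (Fintype.card α - 1) ^ s.card := by
    intro s
    have : (Finset.univ.filter fun c : ι → α => (Finset.univ.filter fun i => c i ≠ 0) = s) =
        Fintype.piFinset fun i => if i ∈ s then Finset.univ.erase 0 else {0} := by
      ext c
      simp only [Finset.mem_filter, Finset.mem_univ, true_and, Fintype.mem_piFinset,
        Finset.ext_iff]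
      refine forall_congr' fun i => ?_
      by_cases hi : i ∈ s <;> simp [hi]
    rw [this, Fintype.card_piFinset]
    have hcard : ∀ i, (if i ∈ s then (Finset.univ : Finset α).erase 0 else {0}).card =
        if i ∈ s then Fintype.card α - 1 else 1 := by
      intro i; split_ifs <;> simp
    simp_rw [hcard]
    rw [Finset.prod_ite_mem]
    simp
  have hw : ∀ i, (Finset.univ.filter fun c : ι → α => weight c = i).card =
      (Fintype.card ι).choose i * (Fintype.card α - 1) ^ i := by
    intro i
    rw [Finset.card_eq_sum_card_fiberwise (f := fun c : ι → α => Finset.univ.filter fun j => c j ≠ 0)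
      (t := Finset.univ.powersetCard i)]
    · rw [Finset.sum_congr rfl (g := fun _ => (Fintype.card α - 1) ^ i)]
      · simp
      · intro s hs
        have hs' := (Finset.mem_powersetCard.1 hs).2
        rw [← hs', ← hsupp s, Finset.filter_filter]
        congr 1
        refine Finset.filter_congr fun c _ => ?_
        simp only [weight]
        exact ⟨fun h => h.2, fun h => ⟨by rw [h], h⟩⟩
    · intro c hc
      simpa [weight, Finset.mem_powersetCard] using hc
  rw [Finset.card_eq_sum_card_fiberwise (f := weight) (t := Finset.range (q + 1))]
  · refine Finset.sum_congr rfl fun i hi => ?_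
    rw [← hw i, Finset.filter_filter]
    congr 1
    refine Finset.filter_congr fun c _ => ?_
    have := Finset.mem_range.1 hi
    exact ⟨fun h => h.2, fun h => ⟨by omega, h⟩⟩
  · intro c hc
    have : weight c ≤ q := by simpa using hc
    simpa [Nat.lt_succ_iff] using this

variable (X G) in
/-- The span of the characters of `X → G` with at most `q` nontrivial coordinates. -/
noncomputable def lowDegree (q : ℕ) : Submodule ℂ ((X → G) → ℂ) :=
  Submodule.span ℂ (prodChar '' {c | weight c ≤ q})

lemma prodChar_mem_lowDegree {q : ℕ} {c : X → AddChar G ℂ} (hc : weight c ≤ q) :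
    prodChar c ∈ lowDegree X G q :=
  Submodule.subset_span ⟨c, hc, rfl⟩

/-- Expand `g` in characters of `G`. Multiplying `prodChar c` by a character of the coordinate `x`
alters `c` only at `x`, so the weight grows by at most one. -/
lemma mul_mem_lowDegree {q : ℕ} {f : (X → G) → ℂ} (hf : f ∈ lowDegree X G q) (g : G → ℂ) (x : X) :
    (fun A => g (A x) * f A) ∈ lowDegree X G (q + 1) := by
  have hg : g ∈ Submodule.span ℂ (Set.range ((⇑) : AddChar G ℂ → G → ℂ)) := by
    rw [← AddChar.coe_complexBasis, Module.Basis.span_eq]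
    trivial
  induction hg using Submodule.span_induction with
  | mem g hg =>
    obtain ⟨ξ, rfl⟩ := hg
    induction hf using Submodule.span_induction with
    | mem f hf =>
      obtain ⟨c, hc, rfl⟩ := hf
      have : (fun A : X → G => ξ (A x) * prodChar c A) =
          prodChar (Function.update c x (ξ + c x)) := by
        funext A
        simp only [prodChar]
        rw [← Finset.mul_prod_erase _ _ (Finset.mem_univ x),
          ← Finset.mul_prod_erase (a := x) _ _ (Finset.mem_univ x)]
        rw [Function.update_self, AddChar.add_apply, mul_assoc]
        congr 2
        refine Finset.prod_congr rfl fun i hi => ?_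
        rw [Function.update_of_ne (Finset.ne_of_mem_erase hi)]
      rw [this]
      refine prodChar_mem_lowDegree ?_
      have hsub : (Finset.univ.filter fun i => Function.update c x (ξ + c x) i ≠ 0) ⊆
          insert x (Finset.univ.filter fun i => c i ≠ 0) := by
        intro i hi
        by_cases hix : i = x
        · simp [hix]
        · simpa [hix] using hi
      exact (Finset.card_le_card hsub).trans ((Finset.card_insert_le _ _).trans
        (Nat.succ_le_succ hc))
    | zero => simpa only [Pi.zero_apply, mul_zero, zero_mul] using! (lowDegree _ G _).zero_mem
    | add f₁ f₂ _ _ h₁ h₂ => simpa [mul_add] using! Submodule.add_mem _ h₁ h₂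
    | smul a f _ h => simpa [mul_left_comm] using! Submodule.smul_mem _ a h
  | zero => simpa only [Pi.zero_apply, mul_zero, zero_mul] using! (lowDegree _ G _).zero_mem
  | add f₁ f₂ _ _ h₁ h₂ => simpa [add_mul] using! Submodule.add_mem _ h₁ h₂
  | smul a f _ h => simpa [mul_assoc] using! Submodule.smul_mem _ a h

/-- The polynomial method for both query models at once: it only matters that a row of the query
matrix depends on `A` through a single value. -/
lemma runQueries_mem_lowDegree {B : Type*} [Fintype B] [DecidableEq B]
    (O : (X → G) → Matrix B B ℂ) (key : B → X) (entry : B → B → G → ℂ)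
    (hO : ∀ A b' b, O A b' b = entry b' b (A (key b'))) (v : B → ℂ) :
    ∀ {q : ℕ} (U : Fin q → Matrix.unitaryGroup B ℂ) (b : B),
      (fun A => runQueries (O A) U v b) ∈ lowDegree X G q
  | 0, U, b => by
    have h : (prodChar (0 : X → AddChar G ℂ)) ∈ lowDegree X G 0 :=
      prodChar_mem_lowDegree (by simp [weight])
    have h' := Submodule.smul_mem _ (v b) h
    convert h' using 1
    funext A
    simp [runQueries, prodChar]
  | q + 1, U, b => by
    have h : (fun A => runQueries (O A) U v b) = ∑ b₁, (U (Fin.last q) : Matrix B B ℂ) b b₁ •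
        ∑ b₂, fun A : X → G => entry b₁ b₂ (A (key b₁)) *
          runQueries (O A) (fun i : Fin q => U i.castSucc) v b₂ := by
      funext A
      simp [runQueries, Matrix.mulVec, dotProduct, hO]
    rw [h]
    exact Submodule.sum_mem _ fun b₁ _ => Submodule.smul_mem _ _ <| Submodule.sum_mem _ fun b₂ _ =>
      mul_mem_lowDegree (runQueries_mem_lowDegree O key entry hO v _ b₂) _ _

/-- A character `c` restricts to a scalar times the character `c ∘ x`; injectivity of `x` keeps the
weight from growing. -/
lemma shift_mem_lowDegree {q : ℕ} {f : (X → G) → ℂ} (hf : f ∈ lowDegree X G q) {x : ι → X}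
    (hx : Function.Injective x) (B : X → G) :
    (fun u : ι → G => f (B + Function.extend x u 0)) ∈ lowDegree ι G q := by
  induction hf using Submodule.span_induction with
  | mem f hf =>
    obtain ⟨c, hc, rfl⟩ := hf
    have h : (fun u : ι → G => prodChar c (B + Function.extend x u 0)) =
        prodChar c B • prodChar (c ∘ x) := by
      funext u
      simp only [prodChar, Pi.add_apply, AddChar.map_add_eq_mul, Finset.prod_mul_distrib,
        Pi.smul_apply, smul_eq_mul, Function.comp_apply]
      congr 1
      symm
      rw [← Finset.prod_image (s := Finset.univ) (g := x)
        (f := fun z => c z (Function.extend x u 0 z)) hx.injOn |>.trans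
          (Finset.prod_congr rfl fun i _ => by rw [hx.extend_apply])]
      -- Off the range of `x` the extension is zero, where characters take the value 1.
      refine Finset.prod_subset (Finset.subset_univ _) fun z _ hz => ?_
      rw [Function.extend_apply' _ _ _ (by simpa using hz)]
      simp
    rw [h]
    refine Submodule.smul_mem _ _ (prodChar_mem_lowDegree (le_trans ?_ hc))
    refine Finset.card_le_card_of_injOn x ?_ hx.injOn
    intro i hi
    simpa using hi
  | zero => simpa only [Pi.zero_apply, mul_zero, zero_mul] using! (lowDegree _ G _).zero_mem
  | add f₁ f₂ _ _ h₁ h₂ => simpa using! Submodule.add_mem _ h₁ h₂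
  | smul a f _ h => simpa using! Submodule.smul_mem _ a h

/-- A function of low degree cannot be concentrated at a point. -/
lemma norm_sq_apply_le_of_mem_lowDegree {q : ℕ} {h : (ι → G) → ℂ} (hh : h ∈ lowDegree ι G q)
    (y : ι → G) :
    ‖h y‖ ^ 2 ≤ ((Finset.univ.filter fun c : ι → AddChar G ℂ => weight c ≤ q).card /
      (Fintype.card G : ℝ) ^ Fintype.card ι) * ∑ u, ‖h u‖ ^ 2 := by
  set W := Finset.univ.filter fun c : ι → AddChar G ℂ => weight c ≤ q with hW
  have hset : {c : ι → AddChar G ℂ | weight c ≤ q} = (W : Set (ι → AddChar G ℂ)) := by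
    ext; simp [hW]
  rw [lowDegree, hset, Submodule.mem_span_image_finset_iff_exists_fun] at hh
  obtain ⟨a, rfl⟩ := hh
  have hparseval : ∑ u, ‖(∑ i, a i • prodChar (i : ι → AddChar G ℂ)) u‖ ^ 2 =
      (Fintype.card G : ℝ) ^ Fintype.card ι * ∑ i, ‖a i‖ ^ 2 := by
    apply Complex.ofReal_injective
    push_cast
    simp_rw [← Complex.mul_conj', Finset.sum_apply, Pi.smul_apply, smul_eq_mul, map_sum, map_mul,
      Finset.sum_mul_sum]
    rw [Finset.sum_comm, Finset.mul_sum]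
    refine Finset.sum_congr rfl fun i _ => ?_
    rw [Finset.sum_comm, Finset.sum_eq_single i]
    · have := sum_prodChar_mul_conj (i : ι → AddChar G ℂ) i
      rw [if_pos rfl] at this
      rw [← this, Finset.sum_mul]
      exact Finset.sum_congr rfl fun u _ => by ring
    · intro j _ hj
      have := sum_prodChar_mul_conj (i : ι → AddChar G ℂ) j
      rw [if_neg fun h => hj (Subtype.ext h.symm)] at this
      rw [← mul_zero (a i * (starRingEnd ℂ) (a j)), ← this, Finset.mul_sum]
      exact Finset.sum_congr rfl fun u _ => by ring
    · simp
  rw [hparseval]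
  have hN : (Fintype.card G : ℝ) ^ Fintype.card ι ≠ 0 := by
    have : (Fintype.card G : ℝ) ≠ 0 := by exact_mod_cast Fintype.card_ne_zero
    positivity
  rw [← mul_assoc, div_mul_cancel₀ _ hN]
  -- Characters have modulus 1; Cauchy–Schwarz then costs the number of characters, the size of `W`.
  have h1 : ‖(∑ i, a i • prodChar (i : ι → AddChar G ℂ)) y‖ ≤ ∑ i, ‖a i‖ := by
    rw [Finset.sum_apply]
    refine (norm_sum_le _ _).trans (Finset.sum_le_sum fun i _ => ?_)
    simp [norm_prodChar]
  calc _ ≤ (∑ i, ‖a i‖) ^ 2 := by gcongr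
    _ ≤ _ := by
      have := sq_sum_le_card_mul_sum_sq (s := Finset.univ) (f := fun i => ‖a i‖)
      simpa using this

/-- A function of low degree cannot be concentrated on the functions with prescribed values at
given distinct points. -/
lemma sum_norm_sq_le_of_mem_lowDegree {q : ℕ} {f : (X → G) → ℂ} (hf : f ∈ lowDegree X G q)
    {x : ι → X} (hx : Function.Injective x) (y : ι → G) :
    ∑ A, (if A ∘ x = y then ‖f A‖ ^ 2 else 0) ≤
      ((Finset.univ.filter fun c : ι → AddChar G ℂ => weight c ≤ q).card /
      (Fintype.card G : ℝ) ^ Fintype.card ι) * ∑ A, ‖f A‖ ^ 2 := by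
  set C : ℝ := (Finset.univ.filter fun c : ι → AddChar G ℂ => weight c ≤ q).card /
      (Fintype.card G : ℝ) ^ Fintype.card ι
  -- Translation identifies every fibre of `A ↦ A ∘ x` with the fibre over zero, so `B` records the
  -- frozen values of `A` off the range of `x`.
  have hshift : ∀ u : ι → G, ∑ A, (if A ∘ x = u then ‖f A‖ ^ 2 else 0) =
      ∑ B : X → G, if B ∘ x = 0 then ‖f (B + Function.extend x u 0)‖ ^ 2 else 0 := by
    intro u
    rw [← Equiv.sum_comp (Equiv.addRight (Function.extend x u (0 : X → G)))]
    refine Finset.sum_congr rfl fun B _ => ?_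
    have : (B + Function.extend x u (0 : X → G) : X → G) ∘ x = u ↔ B ∘ x = 0 := by
      have h : (B + Function.extend x u (0 : X → G) : X → G) ∘ x = B ∘ x + u := by
        funext i; simp [hx.extend_apply]
      rw [h, add_eq_right]
    simp only [Equiv.coe_addRight, this]
  have htotal : ∑ A, ‖f A‖ ^ 2 =
      ∑ B : X → G, if B ∘ x = 0 then ∑ u : ι → G, ‖f (B + Function.extend x u 0)‖ ^ 2 else 0 := by
    calc _ = ∑ A, ∑ u, (if A ∘ x = u then ‖f A‖ ^ 2 else 0) := by simp
      _ = ∑ u : ι → G, ∑ B : X → G, if B ∘ x = 0 then ‖f (B + Function.extend x u 0)‖ ^ 2 else 0 := by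
        rw [Finset.sum_comm]
        exact Finset.sum_congr rfl fun u _ => hshift u
      _ = _ := by
        rw [Finset.sum_comm]
        refine Finset.sum_congr rfl fun B _ => ?_
        split_ifs <;> simp
  rw [hshift y, htotal, Finset.mul_sum]
  refine Finset.sum_le_sum fun B _ => ?_
  split_ifs
  · exact norm_sq_apply_le_of_mem_lowDegree (shift_mem_lowDegree hf hx B) y
  · simp

end Characters

/-! ### Conservation of the norm -/

section Unitary

variable {B : Type*} [Fintype B] [DecidableEq B]

lemma sum_norm_sq_unitary_mulVec {U : Matrix B B ℂ} (hU : U ∈ Matrix.unitaryGroup B ℂ) (v : B → ℂ) :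
    ∑ b, ‖(U *ᵥ v) b‖ ^ 2 = ∑ b, ‖v b‖ ^ 2 := by
  have h : ∀ v : B → ℂ, ((∑ b, ‖v b‖ ^ 2 : ℝ) : ℂ) = star v ⬝ᵥ v := by
    intro v
    simp [dotProduct, ← Complex.conj_mul']
  apply Complex.ofReal_injective
  rw [h, h, Matrix.star_mulVec, Matrix.dotProduct_mulVec, Matrix.vecMul_vecMul,
    ← Matrix.star_eq_conjTranspose, Matrix.mem_unitaryGroup_iff'.1 hU, Matrix.vecMul_one]

lemma sum_norm_sq_runQueries {O : Matrix B B ℂ} (hO : O ∈ Matrix.unitaryGroup B ℂ) (v : B → ℂ) :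
    ∀ {q : ℕ} (U : Fin q → Matrix.unitaryGroup B ℂ),
      ∑ b, ‖runQueries O U v b‖ ^ 2 = ∑ b, ‖v b‖ ^ 2
  | 0, _ => rfl
  | q + 1, U => by
    rw [runQueries, sum_norm_sq_unitary_mulVec (U _).2, sum_norm_sq_unitary_mulVec hO,
      sum_norm_sq_runQueries hO]

end Unitary

/-! ### The upper bound for both query models -/

section UpperBound

variable {X R G : Type*} [Fintype X] [DecidableEq X] [Fintype R] [DecidableEq R]
  [AddCommGroup G] [Fintype G] [DecidableEq G]

/-- If each query operator is unitary and its entries in the row `b` only depend on the value of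
the oracle at `b.1`, then the success probability is at most the proportion of characters of `G ^ k`
of weight at most `q`. -/
theorem successProb_le {q k : ℕ}
    (query : (w : ℕ) → (X → G) → Matrix (X × R × Fin w) (X × R × Fin w) ℂ)
    (hunit : ∀ w A, query w A ∈ Matrix.unitaryGroup (X × R × Fin w) ℂ)
    (entry : (w : ℕ) → X × R × Fin w → X × R × Fin w → G → ℂ)
    (hentry : ∀ w A b' b, query w A b' b = entry w b' b (A b'.1))
    (alg : QueryAlgorithm X R (Fin k → X × G) q) :
    successProb query alg ≤
      (Finset.univ.filter fun c : Fin k → AddChar G ℂ => weight c ≤ q).card /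
        (Fintype.card G : ℝ) ^ k := by
  classical
  set C : ℝ := (Finset.univ.filter fun c : Fin k → AddChar G ℂ => weight c ≤ q).card /
    (Fintype.card G : ℝ) ^ k with hC
  have hC0 : 0 ≤ C := by positivity
  set ψ : X × R × Fin alg.w → (X → G) → ℂ :=
    fun b A => runQueries (query alg.w A) alg.step alg.init b with hψ
  have hb : ∀ b, (∑ A, if IsInterrogation A (alg.out b) then ‖ψ b A‖ ^ 2 else 0) ≤
      C * ∑ A, ‖ψ b A‖ ^ 2 := by
    intro b
    by_cases hinj : Function.Injective fun i => (alg.out b i).1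
    · have hdeg : ψ b ∈ lowDegree X G q :=
        runQueries_mem_lowDegree (query alg.w) (fun b => b.1) (entry alg.w) (hentry alg.w) _ _ b
      have := sum_norm_sq_le_of_mem_lowDegree hdeg hinj fun i => (alg.out b i).2
      rw [Fintype.card_fin] at this
      refine le_trans (le_of_eq (Finset.sum_congr rfl fun A _ => ?_)) this
      refine if_congr ?_ rfl rfl
      simp [IsInterrogation, hinj, funext_iff]
    · have : ∀ A, ¬ IsInterrogation A (alg.out b) := fun A h => hinj h.1
      simp only [this, if_false, Finset.sum_const_zero]
      positivity
  have hcard : (0 : ℝ) < Fintype.card (X → G) := by exact_mod_cast Fintype.card_pos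
  rw [successProb, div_le_iff₀ hcard]
  simp only [successProbOn]
  rw [Finset.sum_comm]
  calc _ ≤ ∑ b, C * ∑ A, ‖ψ b A‖ ^ 2 := Finset.sum_le_sum fun b _ => hb b
    _ = C * ∑ A, ∑ b, ‖ψ b A‖ ^ 2 := by rw [← Finset.mul_sum, Finset.sum_comm]
    _ = C * Fintype.card (X → G) := by
      simp only [hψ, sum_norm_sq_runQueries (hunit _ _), alg.init_unit]
      simp

end UpperBound

/-! ### Unitary matrices and changes of basis -/

section UnitaryMatrices

variable {B : Type*} [Fintype B] [DecidableEq B]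

lemma permMatrix_mem_unitaryGroup (τ : Equiv.Perm B) :
    τ.permMatrix ℂ ∈ Matrix.unitaryGroup B ℂ := by
  rw [Matrix.mem_unitaryGroup_iff, Matrix.star_eq_conjTranspose, Matrix.conjTranspose_permMatrix,
    ← Matrix.permMatrix_mul]
  simp

lemma diagonal_mem_unitaryGroup {d : B → ℂ} (hd : ∀ b, ‖d b‖ = 1) :
    Matrix.diagonal d ∈ Matrix.unitaryGroup B ℂ := by
  rw [Matrix.mem_unitaryGroup_iff, Matrix.star_eq_conjTranspose, Matrix.diagonal_conjTranspose,
    Matrix.diagonal_mul_diagonal, ← Matrix.diagonal_one]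
  congr 1
  funext b
  simp [Complex.mul_conj', hd]

/-- The matrix whose columns are the complex conjugates of the functions `f b`, normalized. -/
noncomputable def conjMatrix (M : ℝ) (f : B → B → ℂ) : Matrix B B ℂ :=
  Matrix.of fun b' b => ((√M)⁻¹ : ℝ) * (starRingEnd ℂ) (f b b')

lemma conjMatrix_mem_unitaryGroup {M : ℝ} (hM : 0 < M) {f : B → B → ℂ}
    (hf : ∀ b₁ b₂, ∑ t, f b₁ t * (starRingEnd ℂ) (f b₂ t) = if b₁ = b₂ then (M : ℂ) else 0) :
    conjMatrix M f ∈ Matrix.unitaryGroup B ℂ := by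
  rw [Matrix.mem_unitaryGroup_iff', Matrix.star_eq_conjTranspose]
  ext b₁ b₂
  rw [Matrix.mul_apply]
  simp only [conjMatrix, Matrix.conjTranspose_apply, Matrix.of_apply, star_mul', RCLike.star_def,
    Complex.conj_conj, Complex.conj_ofReal]
  have hs : ((√M)⁻¹ : ℝ) * ((√M)⁻¹ : ℝ) * M = 1 := by
    rw [← mul_inv, Real.mul_self_sqrt hM.le, inv_mul_cancel₀ hM.ne']
  have hs' : (((√M)⁻¹ : ℝ) : ℂ) * (((√M)⁻¹ : ℝ) : ℂ) * (M : ℂ) = 1 := by exact_mod_cast hs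
  calc _ = (((√M)⁻¹ : ℝ) : ℂ) * (((√M)⁻¹ : ℝ) : ℂ) *
        ∑ t, f b₁ t * (starRingEnd ℂ) (f b₂ t) := by
        rw [Finset.mul_sum]
        exact Finset.sum_congr rfl fun t _ => by ring
    _ = _ := by
      rw [hf, Matrix.one_apply]
      split_ifs
      · exact hs'
      · simp

/-- A change of basis `V` that turns the query operators into simpler ones, and a final unitary `F`,
can be absorbed into the initial state and the unitaries of an algorithm. -/
lemma exists_runQueries_eq_mulVec (V F : Matrix.unitaryGroup B ℂ) (v : B → ℂ)
    (hv : ∑ b, ‖v b‖ ^ 2 = 1) {q : ℕ} (U : Fin q → Matrix.unitaryGroup B ℂ) :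
    ∃ (init : B → ℂ) (step : Fin q → Matrix.unitaryGroup B ℂ), ∑ b, ‖init b‖ ^ 2 = 1 ∧
      ∀ O D : Matrix B B ℂ, O * V = V * D →
        runQueries O step init = (F : Matrix B B ℂ) *ᵥ runQueries D U v := by
  have hV : ((V⁻¹ : Matrix.unitaryGroup B ℂ) : Matrix B B ℂ) * V = 1 := by
    rw [← Submonoid.coe_mul, inv_mul_cancel, Submonoid.coe_one]
  have hconj : ∀ {n : ℕ} (U : Fin n → Matrix.unitaryGroup B ℂ) (O D : Matrix B B ℂ),
      O * V = V * D → runQueries O (fun i => V * U i * V⁻¹) ((V : Matrix B B ℂ) *ᵥ v) =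
        (V : Matrix B B ℂ) *ᵥ runQueries D U v := by
    intro n
    induction n with
    | zero => intros; rfl
    | succ n ih =>
      intro U O D h
      rw [runQueries, ih (fun i => U i.castSucc) O D h, Matrix.mulVec_mulVec _ O, h, Matrix.mulVec_mulVec,
        runQueries, Matrix.mulVec_mulVec, Matrix.mulVec_mulVec]
      congr 1
      rw [Submonoid.coe_mul, Submonoid.coe_mul, mul_assoc, ← mul_assoc _ _ D, hV, one_mul, mul_assoc]
  -- With no queries there is no last unitary to absorb `F`, so it goes into the initial state.
  cases q with
  | zero => exact ⟨(F : Matrix B B ℂ) *ᵥ v, U, (sum_norm_sq_unitary_mulVec F.2 v).trans hv,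
      fun _ _ _ => rfl⟩
  | succ q =>
    -- Conjugating by `V` would leave a final factor `V`; the last unitary has `F` in its place.
    refine ⟨(V : Matrix B B ℂ) *ᵥ v, Function.update (fun i => V * U i * V⁻¹) (Fin.last q)
      (F * U (Fin.last q) * V⁻¹), (sum_norm_sq_unitary_mulVec V.2 v).trans hv, fun O D h => ?_⟩
    have hstep : (fun i : Fin q => Function.update (fun i => V * U i * V⁻¹) (Fin.last q)
        (F * U (Fin.last q) * V⁻¹) i.castSucc) = fun i => V * U i.castSucc * V⁻¹ := by
      funext i
      rw [Function.update_of_ne (Fin.castSucc_lt_last i).ne]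
    rw [runQueries, hstep, hconj (fun i => U i.castSucc) O D h, Function.update_self,
      Matrix.mulVec_mulVec _ O, h, Matrix.mulVec_mulVec, runQueries, Matrix.mulVec_mulVec,
      Matrix.mulVec_mulVec]
    congr 1
    rw [Submonoid.coe_mul, Submonoid.coe_mul, mul_assoc, ← mul_assoc _ _ D, hV, one_mul, mul_assoc]

end UnitaryMatrices

/-! ### The optimal algorithm -/

section LowerBound

variable {X R G Z : Type*} [Fintype X] [DecidableEq X] [Fintype R] [DecidableEq R]
  [AddCommGroup G] [Fintype G] [DecidableEq G] [Fintype Z] [DecidableEq Z]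

/-- The permutation of the basis states that swaps `p z` and `p' z` in the query registers when the
workspace is in the state `z`. -/
def swapPerm (p p' : Z → X × R) : Equiv.Perm (X × R × Z) where
  toFun b := ((Equiv.swap (p b.2.2) (p' b.2.2) (b.1, b.2.1)).1,
    (Equiv.swap (p b.2.2) (p' b.2.2) (b.1, b.2.1)).2, b.2.2)
  invFun b := ((Equiv.swap (p b.2.2) (p' b.2.2) (b.1, b.2.1)).1,
    (Equiv.swap (p b.2.2) (p' b.2.2) (b.1, b.2.1)).2, b.2.2)
  left_inv b := by simp
  right_inv b := by simp

/-- Running the phase queries along a path `p z` controlled by the workspace multiplies the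
amplitude at `z` by the product of the characters met on the path. -/
lemma runQueries_swapPerm (σ : R → AddChar G ℂ) (p : ℕ → Z → X × R) (a : Z → ℂ) (A : X → G) :
    ∀ n : ℕ, runQueries (Matrix.diagonal fun b : X × R × Z => σ b.2.1 (A b.1))
      (fun i : Fin n => ⟨(swapPerm (p i) (p (i + 1))).permMatrix ℂ, permMatrix_mem_unitaryGroup _⟩)
      (fun b => if (b.1, b.2.1) = p 0 b.2.2 then a b.2.2 else 0) =
      fun b => if (b.1, b.2.1) = p n b.2.2 then
        a b.2.2 * ∏ m ∈ Finset.range n, σ (p m b.2.2).2 (A (p m b.2.2).1) else 0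
  | 0 => by simp [runQueries]
  | n + 1 => by
    have ih := runQueries_swapPerm σ p a A n
    rw [runQueries]
    simp only [Fin.val_castSucc, Fin.val_last]
    rw [ih]
    rw [Matrix.permMatrix_mulVec]
    funext b
    obtain ⟨x, r, z⟩ := b
    simp only [Function.comp_apply, Matrix.mulVec_diagonal, swapPerm,
      Equiv.coe_fn_mk, Prod.mk.eta]
    have hiff : Equiv.swap (p n z) (p (n + 1) z) (x, r) = p n z ↔ (x, r) = p (n + 1) z := by
      rw [← Equiv.apply_eq_iff_eq (Equiv.swap (p n z) (p (n + 1) z)), Equiv.swap_apply_self,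
        Equiv.swap_apply_left]
    simp only [hiff]
    split_ifs with h
    · rw [h, Equiv.swap_apply_right, Finset.prod_range_succ]
      ring
    · simp

/-- A character of weight at most `q` can be evaluated by `q` phase queries. -/
lemma exists_query_path {k : ℕ} (σ : R ≃ AddChar G ℂ) (x : Fin k → X) (x₀ : X) (q : ℕ)
    (c : Fin k → AddChar G ℂ) (hc : weight c ≤ q) :
    ∃ p : ℕ → X × R, p q = (x₀, σ.symm 0) ∧
      ∀ A : X → G, ∏ m ∈ Finset.range q, σ (p m).2 (A (p m).1) = prodChar c (A ∘ x) := by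
  have key : ∀ (n : ℕ) (s : Finset (Fin k)), s.card ≤ n → ∃ p : ℕ → X × R, ∀ A : X → G,
      ∏ m ∈ Finset.range n, σ (p m).2 (A (p m).1) = ∏ j ∈ s, c j (A (x j)) := by
    intro n
    induction n with
    | zero =>
      intro s hs
      have : s = ∅ := by simpa using hs
      exact ⟨fun _ => (x₀, σ.symm 0), by simp [this]⟩
    | succ n ih =>
      intro s hs
      rcases s.eq_empty_or_nonempty with rfl | ⟨j, hj⟩
      · exact ⟨fun _ => (x₀, σ.symm 0), by simp⟩
      · obtain ⟨p, hp⟩ := ih (s.erase j) (by rw [Finset.card_erase_of_mem hj]; omega)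
        -- One query per support point; surplus queries use the trivial character.
        refine ⟨Function.update p n (x j, σ.symm (c j)), fun A => ?_⟩
        rw [Finset.prod_range_succ, Function.update_self, ← Finset.prod_erase_mul _ _ hj, ← hp A]
        simp only [Equiv.apply_symm_apply]
        congr 1
        refine Finset.prod_congr rfl fun m hm => ?_
        rw [Function.update_of_ne (Finset.mem_range.1 hm).ne]
  obtain ⟨p, hp⟩ := key q _ hc
  -- The position at time `q` is never queried. A common endpoint disentangles the query registers
  -- from the workspace, so that different characters can interfere.
  refine ⟨Function.update p q (x₀, σ.symm 0), Function.update_self .., fun A => ?_⟩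
  rw [prodChar, ← Finset.prod_subset (Finset.subset_univ (Finset.univ.filter fun i => c i ≠ 0))]
  · refine Eq.trans (Finset.prod_congr rfl fun m hm => ?_) (hp A)
    rw [Function.update_of_ne (Finset.mem_range.1 hm).ne]
  · intro j _ hj
    have : c j = 0 := by simpa using hj
    simp [this]

open scoped Kronecker in
/-- If a change of basis `V` diagonalizes the query operators to phase queries, there is an algorithm
whose success probability is the proportion of characters of `G ^ k` of weight at most `q`. -/
theorem exists_successProb_eq {q k : ℕ} (hk0 : 0 < k) (hk : k ≤ Fintype.card X)
    (query : (w : ℕ) → (X → G) → Matrix (X × R × Fin w) (X × R × Fin w) ℂ)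
    (σ : R ≃ AddChar G ℂ)
    (V : (w : ℕ) → Matrix.unitaryGroup (X × R × Fin w) ℂ)
    (hV : ∀ w A, query w A * V w =
      V w * Matrix.diagonal fun b : X × R × Fin w => σ b.2.1 (A b.1)) :
    ∃ alg : QueryAlgorithm X R (Fin k → X × G) q, successProb query alg =
      (Finset.univ.filter fun c : Fin k → AddChar G ℂ => weight c ≤ q).card /
        (Fintype.card G : ℝ) ^ k := by
  obtain ⟨x⟩ : Nonempty (Fin k ↪ X) := Function.Embedding.nonempty_of_card_le (by simpa using hk)
  set x₀ : X := x ⟨0, hk0⟩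
  set w := Fintype.card (Fin k → G) with hw
  -- The same workspace is read as a character through `e` before the Fourier transform, and as a
  -- list of values through `e'` after it.
  let e' : Fin w ≃ (Fin k → G) := (Fintype.equivFin _).symm
  let e : Fin w ≃ (Fin k → AddChar G ℂ) := Fintype.equivOfCardEq (by simp [hw])
  have hpath : ∀ z : Fin w, ∃ p : ℕ → X × R, p q = (x₀, σ.symm 0) ∧ (weight (e z) ≤ q →
      ∀ A : X → G, ∏ m ∈ Finset.range q, σ (p m).2 (A (p m).1) = prodChar (e z) (A ∘ x)) := by
    intro z
    by_cases hz : weight (e z) ≤ q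
    · obtain ⟨p, h1, h2⟩ := exists_query_path σ x x₀ q (e z) hz
      exact ⟨p, h1, fun _ => h2⟩
    -- Characters that are too heavy get amplitude zero below, so only the endpoint of their path
    -- matters.
    · exact ⟨fun _ => (x₀, σ.symm 0), rfl, fun h => absurd h hz⟩
  choose p hpq hp using hpath
  set m := (Finset.univ.filter fun c : Fin k → AddChar G ℂ => weight c ≤ q).card with hm
  have hm0 : 0 < m := Finset.card_pos.2 ⟨0, by simp [weight]⟩
  have hmz : (Finset.univ.filter fun z => weight (e z) ≤ q).card = m := by
    rw [hm]
    exact Finset.card_equiv e (by simp)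
  set N : ℝ := (Fintype.card G : ℝ) ^ k with hN
  have hN0 : 0 < N := by
    have : (0 : ℝ) < Fintype.card G := by exact_mod_cast Fintype.card_pos
    positivity
  let a : Fin w → ℂ := fun z => if weight (e z) ≤ q then ((√(m : ℝ))⁻¹ : ℝ) else 0
  let v : X × R × Fin w → ℂ := fun b => if (b.1, b.2.1) = p b.2.2 0 then a b.2.2 else 0
  have hv : ∑ b, ‖v b‖ ^ 2 = 1 := by
    have h1 : ∀ b, ‖v b‖ ^ 2 = if (b.1, b.2.1) = p b.2.2 0 then ‖a b.2.2‖ ^ 2 else 0 := by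
      intro b; simp only [v]; split_ifs <;> simp
    simp only [h1]
    rw [← Equiv.sum_comp (Equiv.prodAssoc X R (Fin w)), Fintype.sum_prod_type_right]
    simp only [Equiv.prodAssoc_apply, Prod.mk.eta, Finset.sum_ite_eq', Finset.mem_univ, if_true]
    have h2 : ∀ z, ‖a z‖ ^ 2 = if weight (e z) ≤ q then (m : ℝ)⁻¹ else 0 := by
      intro z
      simp only [a]
      split_ifs
      · rw [Complex.norm_real, Real.norm_eq_abs, sq_abs, inv_pow, Real.sq_sqrt (by positivity)]
      · simp
    simp only [h2]
    rw [← Finset.sum_filter, Finset.sum_const, hmz, nsmul_eq_mul]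
    exact mul_inv_cancel₀ (by positivity)
  let Φ : Matrix (Fin w) (Fin w) ℂ := conjMatrix N fun z t => prodChar (e z) (e' t)
  have hΦ : Φ ∈ Matrix.unitaryGroup (Fin w) ℂ := by
    refine conjMatrix_mem_unitaryGroup hN0 fun z₁ z₂ => ?_
    rw [Equiv.sum_comp e' fun u => prodChar (e z₁) u * (starRingEnd ℂ) (prodChar (e z₂) u),
      sum_prodChar_mul_conj]
    simp [hN]
  let F : Matrix.unitaryGroup (X × R × Fin w) ℂ :=
    ⟨(1 : Matrix X X ℂ) ⊗ₖ ((1 : Matrix R R ℂ) ⊗ₖ Φ),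
      Matrix.kronecker_mem_unitary (one_mem _) (Matrix.kronecker_mem_unitary (one_mem _) hΦ)⟩
  obtain ⟨init, step, hinit, hrun⟩ := exists_runQueries_eq_mulVec (V w) F v hv
    (fun i : Fin q => ⟨(swapPerm (fun z => p z i) (fun z => p z (i + 1))).permMatrix ℂ,
      permMatrix_mem_unitaryGroup _⟩)
  refine ⟨⟨w, init, hinit, step, fun b i => (x i, e' b.2.2 i)⟩, ?_⟩
  have hfinal : ∀ A : X → G, ∀ b, runQueries (query w A) step init b =
      if (b.1, b.2.1) = (x₀, σ.symm 0) then ∑ z, Φ b.2.2 z * (a z * prodChar (e z) (A ∘ x))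
      else 0 := by
    intro A b
    rw [hrun _ _ (hV w A), runQueries_swapPerm σ (fun n z => p z n) a A q]
    obtain ⟨y, r, t⟩ := b
    simp only [Matrix.mulVec, dotProduct, F, Matrix.kroneckerMap_apply, hpq]
    rw [Fintype.sum_prod_type, Finset.sum_eq_single y]
    · rw [Fintype.sum_prod_type, Finset.sum_eq_single r]
      · split_ifs
        · refine Finset.sum_congr rfl fun z _ => ?_
          simp only [Matrix.one_apply_eq, one_mul]
          by_cases hz : weight (e z) ≤ q
          · rw [hp z hz]
          · simp [a, hz]
        · simp
      · intro r' _ hr'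
        simp [Matrix.one_apply_ne' hr']
      · simp
    · intro y' _ hy'
      simp [Matrix.one_apply_ne' hy']
    · simp
  have hsucc : ∀ A : X → G, ‖∑ z, Φ (e'.symm (A ∘ x)) z * (a z * prodChar (e z) (A ∘ x))‖ ^ 2 =
      m / N := by
    intro A
    -- At the true values the Fourier phase cancels the queried phase, so the `m` nonzero terms are
    -- equal and add up constructively.
    have h1 : ∀ z, Φ (e'.symm (A ∘ x)) z * (a z * prodChar (e z) (A ∘ x)) =
        if weight (e z) ≤ q then (((√N)⁻¹ * (√(m : ℝ))⁻¹ : ℝ) : ℂ) else 0 := by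
      intro z
      simp only [Φ, conjMatrix, Matrix.of_apply, Equiv.apply_symm_apply, a]
      split_ifs
      · have := Complex.conj_mul' (prodChar (e z) (A ∘ x))
        rw [norm_prodChar] at this
        push_cast at this ⊢
        linear_combination ((√N : ℂ)⁻¹ * (√(m : ℝ) : ℂ)⁻¹) * this
      · simp
    simp only [h1]
    rw [← Finset.sum_filter, Finset.sum_const, hmz, nsmul_eq_mul, ← Complex.ofReal_natCast,
      ← Complex.ofReal_mul, Complex.norm_real, Real.norm_eq_abs, sq_abs, mul_pow, mul_pow, inv_pow,
      inv_pow, Real.sq_sqrt hN0.le, Real.sq_sqrt (by positivity)]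
    have : (m : ℝ) ≠ 0 := by positivity
    field_simp
  have hprob : ∀ A : X → G, successProbOn query
      (⟨w, init, hinit, step, fun b i => (x i, e' b.2.2 i)⟩ :
        QueryAlgorithm X R (Fin k → X × G) q) A = m / N := by
    intro A
    rw [← hsucc A, successProbOn]
    have hint : ∀ t, IsInterrogation A (fun i => (x i, e' t i)) ↔ t = e'.symm (A ∘ x) := by
      intro t
      rw [Equiv.eq_symm_apply]
      simp only [IsInterrogation]
      refine ⟨fun h => funext fun i => (h.2 i).symm, fun h => ⟨x.injective, fun i => ?_⟩⟩
      rw [h]; rfl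
    rw [Finset.sum_eq_single (x₀, σ.symm 0, e'.symm (A ∘ x))]
    · rw [if_pos ((hint _).2 rfl), hfinal, if_pos rfl]
    · intro b _ hb
      rw [hfinal]
      split_ifs with h1 h2
      · refine absurd ?_ hb
        have h1' := (hint _).1 h1
        obtain ⟨y, r, t⟩ := b
        simp only [Prod.mk.injEq] at h2 h1' ⊢
        exact ⟨h2.1, h2.2, h1'⟩
      · simp
      · rfl
    · simp
  rw [successProb]
  simp only [hprob, Finset.sum_const, Finset.card_univ, nsmul_eq_mul]
  exact mul_div_cancel_left₀ _ (by exact_mod_cast Fintype.card_ne_zero)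

end LowerBound

/-! ### The two query operators -/

section Queries

variable {X G : Type*} [Fintype X] [DecidableEq X] [AddCommGroup G] [Fintype G] [DecidableEq G]

lemma phaseQuery_mem_unitaryGroup (w : ℕ) (A : X → G) :
    phaseQuery w A ∈ Matrix.unitaryGroup (X × AddChar G ℂ × Fin w) ℂ :=
  diagonal_mem_unitaryGroup fun b => AddChar.norm_apply b.2.1 (A b.1)

/-- The permutation `|x, g, z⟩ ↦ |x, g - A x, z⟩` of the basis states. -/
def subPerm (w : ℕ) (A : X → G) : Equiv.Perm (X × G × Fin w) where
  toFun b := (b.1, b.2.1 - A b.1, b.2.2)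
  invFun b := (b.1, b.2.1 + A b.1, b.2.2)
  left_inv b := by simp
  right_inv b := by simp

lemma addQuery_eq_permMatrix (w : ℕ) (A : X → G) :
    addQuery w A = (subPerm w A).permMatrix ℂ := by
  ext b' b
  simp only [addQuery, Matrix.of_apply, Equiv.Perm.permMatrix, PEquiv.toMatrix_apply,
    Equiv.toPEquiv_apply, Option.mem_def, Option.some.injEq]
  exact if_congr (Equiv.eq_symm_apply (subPerm w A)) rfl rfl

-- Conjugated characters are common eigenvectors of all translations of `G`, so the Fourier
-- transform of the response register serves for every `A` at once.
open scoped Kronecker in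
lemma exists_addQuery_diagonalization (σ : G ≃ AddChar G ℂ) (w : ℕ) :
    ∃ V : Matrix.unitaryGroup (X × G × Fin w) ℂ, ∀ A : X → G, addQuery w A * V =
      V * Matrix.diagonal fun b : X × G × Fin w => σ b.2.1 (A b.1) := by
  have hQ : conjMatrix (Fintype.card G) (fun r g => σ r g) ∈ Matrix.unitaryGroup G ℂ := by
    refine conjMatrix_mem_unitaryGroup (by exact_mod_cast Fintype.card_pos) fun r₁ r₂ => ?_
    rw [sum_addChar_mul_conj]
    simp
  refine ⟨⟨(1 : Matrix X X ℂ) ⊗ₖ (conjMatrix (Fintype.card G) (fun r g => σ r g) ⊗ₖ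
    (1 : Matrix (Fin w) (Fin w) ℂ)), Matrix.kronecker_mem_unitary (one_mem _)
      (Matrix.kronecker_mem_unitary hQ (one_mem _))⟩, fun A => ?_⟩
  rw [addQuery_eq_permMatrix]
  ext ⟨x', g, z'⟩ ⟨x, r, z⟩
  rw [Matrix.mul_diagonal, Equiv.Perm.permMatrix, PEquiv.toMatrix_toPEquiv_mul]
  simp only [Matrix.submatrix_apply, Matrix.kroneckerMap_apply, subPerm, Equiv.coe_fn_mk, id,
    conjMatrix, Matrix.of_apply]
  rcases eq_or_ne x' x with rfl | hx
  · rw [sub_eq_add_neg, AddChar.map_add_eq_mul, AddChar.map_neg_eq_conj, map_mul,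
      Complex.conj_conj]
    ring
  · simp [Matrix.one_apply_ne hx]

end Queries

/-- Oracle interrogation: the maximum success probability of `q`-query quantum algorithms, both
with controlled-add queries and with phase queries. -/
theorem theorem5p2 {X G : Type*} [Fintype X] [DecidableEq X] [AddCommGroup G] [Fintype G]
    [DecidableEq G] (q k : ℕ) (hqk : q < k) (hk : k ≤ Fintype.card X) :
    IsGreatest
      {p : ℝ | ∃ alg : QueryAlgorithm X G (Fin k → X × G) q, successProb addQuery alg = p}
      (1 / (Fintype.card G : ℝ) ^ k *
        ∑ i ∈ Finset.range (q + 1), (k.choose i : ℝ) * ((Fintype.card G : ℝ) - 1) ^ i) ∧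
    IsGreatest
      {p : ℝ | ∃ alg : QueryAlgorithm X (AddChar G ℂ) (Fin k → X × G) q,
        successProb phaseQuery alg = p}
      (1 / (Fintype.card G : ℝ) ^ k *
        ∑ i ∈ Finset.range (q + 1), (k.choose i : ℝ) * ((Fintype.card G : ℝ) - 1) ^ i) := by
  have hcount : 1 / (Fintype.card G : ℝ) ^ k *
      ∑ i ∈ Finset.range (q + 1), (k.choose i : ℝ) * ((Fintype.card G : ℝ) - 1) ^ i =
      (Finset.univ.filter fun c : Fin k → AddChar G ℂ => weight c ≤ q).card /
        (Fintype.card G : ℝ) ^ k := by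
    rw [card_weight_le, AddChar.card_eq, Fintype.card_fin, div_mul_eq_mul_div, one_mul]
    push_cast [Nat.cast_sub (Fintype.card_pos : 0 < Fintype.card G)]
    rfl
  have hk0 : 0 < k := by omega
  rw [hcount]
  refine ⟨⟨?_, ?_⟩, ⟨?_, ?_⟩⟩
  -- Any labelling of the characters by elements of `G` will do; it need not respect addition.
  · let σ : G ≃ AddChar G ℂ := Fintype.equivOfCardEq AddChar.card_eq.symm
    choose V hV using exists_addQuery_diagonalization (X := X) σ
    exact exists_successProb_eq hk0 hk addQuery σ V hV
  · rintro _ ⟨alg, rfl⟩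
    refine successProb_le addQuery
      (fun w A => addQuery_eq_permMatrix w A ▸ permMatrix_mem_unitaryGroup _)
      -- A row is indexed by the state after the query, hence the subtraction.
      (fun w b' b g => if (b'.1, b'.2.1 - g, b'.2.2) = b then 1 else 0) (fun w A b' b => ?_) alg
    rw [addQuery_eq_permMatrix]
    simp [Equiv.Perm.permMatrix, PEquiv.toMatrix_apply, subPerm, Equiv.toPEquiv_apply]
  · exact exists_successProb_eq hk0 hk phaseQuery (Equiv.refl _) (fun _ => 1)
      fun w A => by simp [phaseQuery]
  · rintro _ ⟨alg, rfl⟩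
    exact successProb_le phaseQuery phaseQuery_mem_unitaryGroup
      (fun w b' b g => if b' = b then b'.2.1 g else 0)
      (fun w A b' b => by rw [phaseQuery, Matrix.diagonal_apply]) alg
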